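/- For a group $G$ and a natural number $n$, let $r_n(G)\in\{0,1,2,\dots\}\cup\{\infty\}$ denote the number of inequivalent complex irreducible representations of $G$ of dimension $n$ whose kernels have finite index in $G$. Let $G$ be an infinite, finitely generated, residually finite group, and let $I(G)$ be the set of all natural numbers $i$ such that $r_i(G)=\infty$. The following are equivalent: (i) $I(G)$ is finite and non-empty; (ii) $r_i(G)=0$ for all sufficiently large $i$; (iii) $G$ is virtually abelian, that is, $G$ has an abelian subgroup of finite index. -/

import Mathlib

/-- The complex irreducible representations of `G` on `ℂⁿ` whose kernel has finite index in `G`.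
Every `n`-dimensional complex representation is isomorphic to one on `ℂⁿ`. -/
def FiniteImageIrrep (G : Type*) [Group G] (n : ℕ) : Type _ :=
  {ρ : Representation ℂ G (Fin n → ℂ) // ρ.IsIrreducible ∧ (MonoidHom.ker ρ).FiniteIndex}

/-- Equivalence (that is, isomorphism) of representations. -/
instance FiniteImageIrrep.setoid (G : Type*) [Group G] (n : ℕ) :
    Setoid (FiniteImageIrrep G n) where
  r ρ σ := Nonempty (Representation.Equiv ρ.1 σ.1)
  iseqv :=
    { refl := fun _ => ⟨Representation.Equiv.refl _⟩
      symm := fun ⟨e⟩ => ⟨e.symm⟩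
      trans := fun ⟨e⟩ ⟨f⟩ => ⟨e.trans f⟩ }

/-- `r_n(G)`: the number, in `ℕ ∪ {∞}`, of inequivalent complex irreducible representations of `G`
of dimension `n` whose kernels have finite index. -/
noncomputable def repCount (G : Type*) [Group G] (n : ℕ) : ℕ∞ :=
  ENat.card (Quotient (FiniteImageIrrep.setoid G n))

/-- `I(G)`: the set of all natural numbers `i` such that `r_i(G) = ∞`. -/
def infiniteDegrees (G : Type*) [Group G] : Set ℕ :=
  {i | repCount G i = ⊤}

/-- `G` is virtually abelian: it has an abelian subgroup of finite index. -/
def IsVirtuallyAbelian (G : Type*) [Group G] : Prop :=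
  ∃ H : Subgroup G, H.FiniteIndex ∧ ∀ x ∈ H, ∀ y ∈ H, x * y = y * x

/-!
# Groups with irreducible representations of bounded degree

All representations in this outline are complex and have finite image, and they are counted up to
equivalence. The four implications rest on three ingredients.

*Jordan's theorem* (`exists_forall_representation_exists_commute_index_le`): in every
representation of dimension `n` some subgroup of index at most `J n` acts through an abelian group.
After unitarization, two group elements at distance less than `1 / 2` from the identity commute,
because commutators with one of them shrink; such elements generate the required subgroup, and its
index is bounded by covering the unit ball of operators by small balls. As `G` is finitely
generated, one finite-index subgroup `H` works for all representations of dimension below a given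
bound (`exists_finiteIndex_commute`).

*Frobenius reciprocity* (`exists_finiteImageIrrep_twist`): for a finite-index subgroup `H`, a
character `χ` of `H` and a representation `σ` of `G`, a constituent `τ` of `σ ⊗ Ind χ` has dimension
at most `[G : H] dim σ` and its restriction to `H` maps nontrivially to `χ ⊗ σ`. With `σ` trivial
and `H` the preimage of a cyclic subgroup of a finite quotient, it shows that irreducible
representations separate the points of a residually finite group.

*Common kernels*: there are finitely many irreducible representations of dimension `n` if and only
if their common kernel `irrepKernel G n` has finite index.

If all degrees are bounded, `H` acts through abelian groups in every irreducible representation, so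
it is abelian; conversely an abelian subgroup of finite index bounds the degrees by its index. Also,
if the degrees are bounded and `G` is infinite, some `r_i(G)` is infinite, as otherwise the trivial
subgroup would be a finite intersection of common kernels. Finally, let `r_n(G) = ∞` and let `H` act
through abelian groups in dimension `n`. Then the characters of `H` have a common kernel of infinite
index. For irreducible `σ` of dimension `m`, the constituents of `σ ⊗ Ind χ`, for varying `χ`, have
dimensions between `m / [G : H]` and `m [G : H]`, and they are infinitely many since they determine
`χ` on the kernel of `σ`. So `I(G)` has an element at least `m / [G : H]`; if it is bounded, so is
`m`.
-/

/-! ### Jordan's theorem for representations with finite image -/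

theorem MonoidHom.finite_range_of_finiteIndex_ker {G M : Type*} [Group G] [Monoid M] (f : G →* M)
    (hf : f.ker.FiniteIndex) : (Set.range f).Finite := by
  let F : G ⧸ f.ker → M := Quotient.lift f fun x y hxy => by
    have h : f (x⁻¹ * y) = 1 := QuotientGroup.leftRel_apply.mp hxy
    rw [← mul_one (f x), ← h, ← map_mul, mul_inv_cancel_left]
  exact (Set.finite_range F).subset fun _ ⟨g, hg⟩ => ⟨QuotientGroup.mk g, hg⟩

section Jordan

variable {E : Type*} [NormedAddCommGroup E] [InnerProductSpace ℂ E] [FiniteDimensional ℂ E]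

theorem LinearMap.exists_eigenvector_mem {V : Type*} [AddCommGroup V] [Module ℂ V]
    [FiniteDimensional ℂ V] (f : Module.End ℂ V) {W : Submodule ℂ V} (hW : W ≠ ⊥)
    (hf : ∀ v ∈ W, f v ∈ W) : ∃ μ : ℂ, ∃ v ∈ W, v ≠ 0 ∧ f v = μ • v := by
  have : Nontrivial W := Submodule.nontrivial_iff_ne_bot.mpr hW
  obtain ⟨μ, hμ⟩ := Module.End.exists_eigenvalue (f.restrict hf)
  obtain ⟨v, hv⟩ := hμ.exists_hasEigenvector
  refine ⟨μ, v, v.2, fun h => hv.2 (Subtype.ext h), ?_⟩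
  have := congrArg Subtype.val hv.apply_eq_smul
  simpa using this

theorem inner_eq_zero_of_unitary_eigenvectors (b : unitary (E →L[ℂ] E)) {v w : E} {μ ν : ℂ}
    (hv : (b : E →L[ℂ] E) v = μ • v) (hw : (b : E →L[ℂ] E) w = ν • w) (hv0 : v ≠ 0)
    (hμν : μ ≠ ν) : inner ℂ v w = 0 := by
  have hnorm : ‖μ‖ = 1 := by
    have h := (b : E →L[ℂ] E).norm_map_of_mem_unitary b.2 v
    rw [hv, norm_smul] at h
    exact mul_right_cancel₀ (norm_ne_zero_iff.mpr hv0) (by rw [h, one_mul])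
  have hμ : μ * (starRingEnd ℂ) μ = 1 := by
    rw [Complex.mul_conj']; simp [hnorm]
  have h := (b : E →L[ℂ] E).inner_map_map_of_mem_unitary b.2 v w
  rw [hv, hw, inner_smul_left, inner_smul_right, ← mul_assoc] at h
  by_contra h0
  have h1 : (starRingEnd ℂ) μ * ν = 1 := mul_right_cancel₀ h0 (by rw [h, one_mul])
  apply hμν
  calc μ = μ * ((starRingEnd ℂ) μ * ν) := by rw [h1, mul_one]
    _ = ν := by rw [← mul_assoc, hμ, one_mul]

/-- A unitary `b` commuting with its commutator with a unitary `x` near `1` commutes with `x`.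
Otherwise `b` and the commutator `c` have a common eigenvector `v` with `c v = ν v`, `ν ≠ 1`.
Then `v` and `x⁻¹ v` are eigenvectors of `b` for different eigenvalues, hence orthogonal, so `x`
moves `x⁻¹ v` far away. -/
theorem commute_of_commute_commutator (b x : unitary (E →L[ℂ] E))
    (h : Commute b (b * x * b⁻¹ * x⁻¹)) (hx : ‖(x : E →L[ℂ] E) - 1‖ < 1) : Commute b x := by
  set c := b * x * b⁻¹ * x⁻¹ with hc
  by_contra hbx
  have hc1 : c ≠ 1 := fun h1 => hbx <| by
    have : b * x = x * b := by
      rw [hc, mul_inv_eq_one, mul_inv_eq_iff_eq_mul] at h1; exact h1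
    exact this
  let B : E →L[ℂ] E := b
  let C : E →L[ℂ] E := c
  let X : E →L[ℂ] E := x
  have hBC (v : E) : B (C v) = C (B v) := by
    have := congrArg (fun u : unitary (E →L[ℂ] E) => (u : E →L[ℂ] E) v) h.eq
    exact this
  -- the range of `c - 1` meets no fixed vector of the unitary `c`
  let W : Submodule ℂ E := LinearMap.range ((C - 1 : E →L[ℂ] E) : E →ₗ[ℂ] E)
  have hW : W ≠ ⊥ := by
    intro h0
    rw [LinearMap.range_eq_bot] at h0
    apply hc1
    apply Subtype.ext
    have : C - 1 = 0 := by ext v; exact LinearMap.congr_fun h0 v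
    exact sub_eq_zero.mp this
  have hCW : ∀ v ∈ W, C v ∈ W := by
    rintro _ ⟨u, rfl⟩
    exact ⟨C u, by simp⟩
  have hBW : ∀ v ∈ W, B v ∈ W := by
    rintro _ ⟨u, rfl⟩
    exact ⟨B u, by simp [hBC]⟩
  obtain ⟨ν, v₀, hv₀W, hv₀, hCv₀⟩ := LinearMap.exists_eigenvector_mem (C : E →ₗ[ℂ] E) hW hCW
  have hW' : W ⊓ Module.End.eigenspace (C : E →ₗ[ℂ] E) ν ≠ ⊥ :=
    (Submodule.ne_bot_iff _).mpr ⟨v₀, ⟨hv₀W, Module.End.mem_eigenspace_iff.mpr hCv₀⟩, hv₀⟩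
  obtain ⟨μ, v, ⟨hvW, hvC⟩, hv, hBv⟩ := LinearMap.exists_eigenvector_mem (B : E →ₗ[ℂ] E) hW' (by
    rintro v ⟨h1, h2⟩
    refine ⟨hBW v h1, Module.End.mem_eigenspace_iff.mpr ?_⟩
    have h2 : C v = ν • v := Module.End.mem_eigenspace_iff.mp h2
    change C (B v) = ν • B v
    rw [← hBC, h2, map_smul])
  replace hvC : C v = ν • v := Module.End.mem_eigenspace_iff.mp hvC
  replace hBv : B v = μ • v := hBv
  have hν : ν ≠ 1 := by
    rintro rfl
    rw [one_smul] at hvC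
    obtain ⟨u, hu⟩ := hvW
    have hu' : C u - u = v := by simpa using hu
    have h1 : inner ℂ (C u) (C v) = inner ℂ u v :=
      C.inner_map_map_of_mem_unitary c.2 u v
    rw [hvC, ← sub_eq_zero, ← inner_sub_left, hu'] at h1
    exact hv (inner_self_eq_zero.mp h1)
  -- `w = x⁻¹ v` satisfies `b w = (μ / ν) w`
  let w : E := ((x⁻¹ : unitary (E →L[ℂ] E)) : E →L[ℂ] E) v
  have hXw : X w = v := by
    have := congrArg (fun u : unitary (E →L[ℂ] E) => (u : E →L[ℂ] E) v) (mul_inv_cancel x)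
    exact this
  have hCXB : C (X (B w)) = B v := by
    have h2 : c * (x * (b * x⁻¹)) = b := by rw [hc]; group
    have := congrArg (fun u : unitary (E →L[ℂ] E) => (u : E →L[ℂ] E) v) h2
    exact this
  have hμ : ν * (ν⁻¹ * μ) = μ := by
    have hν0 : ν ≠ 0 := by
      rintro rfl
      have := C.norm_map_of_mem_unitary c.2 v
      rw [hvC, zero_smul, norm_zero] at this
      exact hv (norm_eq_zero.mp this.symm)
    field_simp
  have hinj (u : unitary (E →L[ℂ] E)) : Function.Injective (u : E →L[ℂ] E) := by
    rw [injective_iff_map_eq_zero]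
    intro y hy
    have := (u : E →L[ℂ] E).norm_map_of_mem_unitary u.2 y
    rw [hy, norm_zero] at this
    exact norm_eq_zero.mp this.symm
  have hBw : B w = (ν⁻¹ * μ) • w := by
    apply hinj x
    apply hinj c
    change C (X (B w)) = C (X _)
    rw [hCXB, map_smul, hXw, map_smul, hvC, smul_smul, mul_comm _ ν, hμ, hBv]
  have hw : w ≠ 0 := fun h0 => hv (by rw [← hXw, h0, map_zero])
  have horth : inner ℂ w v = 0 := by
    refine inner_eq_zero_of_unitary_eigenvectors b hBw hBv hw fun he => hν ?_
    rw [he] at hμ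
    have hμ0 : μ ≠ 0 := by
      rintro rfl
      have := B.norm_map_of_mem_unitary b.2 v
      rw [hBv, zero_smul, norm_zero] at this
      exact hv (norm_eq_zero.mp this.symm)
    exact mul_right_cancel₀ hμ0 (by rw [hμ, one_mul])
  have h1 : ‖v - w‖ < ‖w‖ := by
    have : v - w = (X - 1) w := by simp [hXw]
    rw [this]
    calc ‖(X - 1) w‖ ≤ ‖X - 1‖ * ‖w‖ := (X - 1).le_opNorm w
      _ < 1 * ‖w‖ := mul_lt_mul_of_pos_right hx (norm_pos_iff.mpr hw)
      _ = ‖w‖ := one_mul _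
  have h2 : ‖v - w‖ * ‖v - w‖ = ‖v‖ * ‖v‖ + ‖w‖ * ‖w‖ := by
      rw [norm_sub_mul_self (𝕜 := ℂ), inner_eq_zero_symm.mp horth]
      simp
  nlinarith [norm_nonneg v, norm_nonneg (v - w), norm_nonneg w]

theorem norm_unitary_commutator_sub_one_le {A : Type*} [CStarAlgebra A] [Nontrivial A]
    (a b : unitary A) :
    ‖((a * b * a⁻¹ * b⁻¹ : unitary A) : A) - 1‖ ≤ 2 * ‖(a : A) - 1‖ * ‖(b : A) - 1‖ := by
  have h := norm_commutator_units_sub_one_le (Unitary.toUnits a) (Unitary.toUnits b)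
  rw [← map_inv, ← map_inv, ← map_mul, ← map_mul, ← map_mul] at h
  simp only [Unitary.val_toUnits_apply, CStarRing.norm_coe_unitary, mul_one] at h
  exact h

/-- Elements of a finite group of unitary operators at distance less than `1 / 2` from `1` commute:
commutators with a fixed such `b` are closer to `1` than the elements they come from, so an element
closest to `1` among those not commuting with `b` would contradict
`commute_of_commute_commutator`. -/
theorem commute_of_norm_sub_one_lt {G : Type*} [Group G] (φ : G →* unitary (E →L[ℂ] E))
    (hφ : (Set.range φ).Finite) {g h : G} (hg : ‖(φ g : E →L[ℂ] E) - 1‖ < 1 / 2)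
    (hh : ‖(φ h : E →L[ℂ] E) - 1‖ < 1 / 2) : Commute (φ g) (φ h) := by
  rcases subsingleton_or_nontrivial E with hE | hE
  · exact Subtype.ext (ContinuousLinearMap.ext fun _ => Subsingleton.elim _ _)
  let S : Set (unitary (E →L[ℂ] E)) :=
    {x | x ∈ Set.range φ ∧ ‖(x : E →L[ℂ] E) - 1‖ < 1 / 2 ∧ ¬ Commute (φ g) x}
  by_contra hcomm
  have hS : S.Finite := hφ.subset fun x hx => hx.1
  obtain ⟨x, ⟨⟨k, rfl⟩, hx2, hx3⟩, hmin⟩ := Set.exists_min_image S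
    (fun x => ‖(x : E →L[ℂ] E) - 1‖) hS ⟨φ h, ⟨h, rfl⟩, hh, hcomm⟩
  apply hx3
  refine commute_of_commute_commutator _ _ ?_ (hx2.trans (by norm_num))
  by_contra hc
  have hpos : 0 < ‖(φ k : E →L[ℂ] E) - 1‖ := by
    rw [norm_pos_iff, sub_ne_zero]
    intro h1
    apply hx3
    rw [show φ k = 1 from Subtype.ext h1]
    exact Commute.one_right _
  have hlt : ‖((φ g * φ k * (φ g)⁻¹ * (φ k)⁻¹ : unitary (E →L[ℂ] E)) : E →L[ℂ] E) - 1‖ <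
      ‖(φ k : E →L[ℂ] E) - 1‖ := by
    refine (norm_unitary_commutator_sub_one_le _ _).trans_lt ?_
    nlinarith
  exact absurd (hmin _ ⟨⟨g * k * g⁻¹ * k⁻¹, by simp⟩, hlt.trans hx2, hc⟩) (not_le.mpr hlt)

variable (E) in
/-- Jordan's theorem for unitary representations with finite image. -/
theorem exists_forall_unitary_exists_commute_index_le : ∃ J : ℕ, ∀ (G : Type*) [Group G]
    (φ : G →* unitary (E →L[ℂ] E)), (Set.range φ).Finite → ∃ K : Subgroup G, K.index ≤ J ∧
      K.FiniteIndex ∧ ∀ x ∈ K, ∀ y ∈ K, Commute (φ x) (φ y) := by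
  obtain ⟨t, -, htf, ht⟩ := finite_cover_balls_of_compact
    (isCompact_closedBall (0 : E →L[ℂ] E) 1) (show (0 : ℝ) < 1 / 4 by norm_num)
  refine ⟨htf.toFinset.card, fun G _ φ hφ => ?_⟩
  let S : Set G := {g | ‖(φ g : E →L[ℂ] E) - 1‖ < 1 / 2}
  let K : Subgroup G := Subgroup.closure S
  have hball (g : G) : ∃ c ∈ t, dist (φ g : E →L[ℂ] E) c < 1 / 4 := by
    have hg : (φ g : E →L[ℂ] E) ∈ Metric.closedBall (0 : E →L[ℂ] E) 1 := by
      rw [mem_closedBall_zero_iff]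
      refine ContinuousLinearMap.opNorm_le_bound _ zero_le_one fun v => ?_
      rw [one_mul, (φ g : E →L[ℂ] E).norm_map_of_mem_unitary (φ g).2]
    simpa using ht hg
  choose c hct hc using hball
  let f : G ⧸ K → htf.toFinset := fun q => ⟨c q.out, htf.mem_toFinset.mpr (hct _)⟩
  have hf : Function.Injective f := by
    intro p q hpq
    have hpq : c p.out = c q.out := congrArg Subtype.val hpq
    rw [← p.out_eq, ← q.out_eq]
    refine QuotientGroup.eq.mpr (Subgroup.subset_closure ?_)
    change ‖((φ (p.out⁻¹ * q.out) : unitary (E →L[ℂ] E)) : E →L[ℂ] E) - 1‖ < 1 / 2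
    have h1 : ((φ (p.out⁻¹ * q.out) : unitary (E →L[ℂ] E)) : E →L[ℂ] E) - 1 =
        (((φ p.out)⁻¹ : unitary (E →L[ℂ] E)) : E →L[ℂ] E) *
          ((φ q.out : E →L[ℂ] E) - (φ p.out : E →L[ℂ] E)) := by
      rw [mul_sub, ← Submonoid.coe_mul, ← Submonoid.coe_mul, inv_mul_cancel, map_mul, map_inv]
      rfl
    rw [h1, CStarRing.norm_coe_unitary_mul, ← dist_eq_norm]
    have h2 := hc p.out
    have h3 := hc q.out
    rw [hpq] at h2
    have h4 := dist_triangle_right (φ q.out : E →L[ℂ] E) (φ p.out) (c q.out)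
    linarith
  have hfin : Finite (G ⧸ K) := Finite.of_injective f hf
  refine ⟨K, ?_, Subgroup.finiteIndex_of_finite_quotient, fun x hx y hy => ?_⟩
  · rw [Subgroup.index]
    exact (Nat.card_le_card_of_injective f hf).trans_eq (Nat.card_eq_finsetCard _)
  · induction hx, hy using Subgroup.closure_induction₂ with
    | mem x y hx hy => exact commute_of_norm_sub_one_lt φ hφ hx hy
    | one_left y _ => simp
    | one_right x _ => simp
    | mul_left x y z _ _ _ h1 h2 => rw [map_mul]; exact h1.mul_left h2
    | mul_right x y z _ _ _ h1 h2 => rw [map_mul]; exact h1.mul_right h2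
    | inv_left x y _ _ h => rw [map_inv]; exact h.inv_left
    | inv_right x y _ _ h => rw [map_inv]; exact h.inv_right

/-- Weyl's trick: a finite group of invertible elements of a C⋆-algebra is conjugate to a group of
unitaries, the conjugating element being the square root of `∑ r⋆ r`. -/
theorem exists_unitary_conj {A : Type*} [CStarAlgebra A] [PartialOrder A] [StarOrderedRing A]
    {G : Type*} [Group G] (ρ : G →* A) (hρ : (Set.range ρ).Finite) :
    ∃ s : Aˣ, ∀ g, (s : A) * ρ g * (s⁻¹ : Aˣ) ∈ unitary A := by
  classical
  let R : Finset A := hρ.toFinset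
  let P : A := ∑ r ∈ R, star r * r
  have hmem (r : A) : r ∈ R ↔ ∃ g, ρ g = r := by simp [R]
  have hinv (g : G) : star (ρ g) * P * ρ g = P := by
    simp only [P, Finset.mul_sum, Finset.sum_mul]
    refine Finset.sum_bij' (fun r _ => r * ρ g) (fun r _ => r * ρ g⁻¹) ?_ ?_ ?_ ?_ ?_
    · intro r hr
      obtain ⟨k, rfl⟩ := (hmem r).mp hr
      exact (hmem _).mpr ⟨k * g, map_mul _ _ _⟩
    · intro r hr
      obtain ⟨k, rfl⟩ := (hmem r).mp hr
      exact (hmem _).mpr ⟨k * g⁻¹, map_mul _ _ _⟩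
    · intro r _; simp [mul_assoc, ← map_mul]
    · intro r _; simp [mul_assoc, ← map_mul]
    · intro r _; simp [mul_assoc]
  have hP1 : 1 ≤ P := by
    have h1 : (1 : A) ∈ R := (hmem 1).mpr ⟨1, map_one ρ⟩
    calc (1 : A) = star 1 * 1 := by simp
      _ ≤ P := Finset.single_le_sum (f := fun r : A => star r * r)
        (fun r _ => star_mul_self_nonneg r) h1
  have hP0 : 0 ≤ P := zero_le_one.trans hP1
  have hPu : IsUnit P := CStarAlgebra.isUnit_of_le 1 hP1
  obtain ⟨s, hs⟩ := (CFC.isUnit_sqrt_iff P hP0).mpr hPu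
  have hss : (s : A) * s = P := by rw [hs, CFC.sqrt_mul_sqrt_self P hP0]
  have hsa : star (s : A) = s := by
    rw [hs]; exact (IsSelfAdjoint.of_nonneg (CFC.sqrt_nonneg P)).star_eq
  have hsa' : star ((s⁻¹ : Aˣ) : A) = (s⁻¹ : Aˣ) := by
    rw [← Units.coe_star_inv]
    have : star s = s := Units.ext hsa
    rw [this]
  have hiso (g : G) : star ((s : A) * ρ g * (s⁻¹ : Aˣ)) * ((s : A) * ρ g * (s⁻¹ : Aˣ)) = 1 := by
    calc star ((s : A) * ρ g * (s⁻¹ : Aˣ)) * ((s : A) * ρ g * (s⁻¹ : Aˣ))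
        = (s⁻¹ : Aˣ) * (star (ρ g) * (s * s) * ρ g) * (s⁻¹ : Aˣ) := by
          rw [star_mul, star_mul, hsa, hsa']; simp only [mul_assoc]
      _ = (s⁻¹ : Aˣ) * (s * s) * (s⁻¹ : Aˣ) := by rw [hss, hinv]
      _ = 1 := by simp
  refine ⟨s, fun g => Unitary.mem_iff.mpr ⟨hiso g, ?_⟩⟩
  have hr : ((s : A) * ρ g * (s⁻¹ : Aˣ)) * ((s : A) * ρ g⁻¹ * (s⁻¹ : Aˣ)) = 1 := by
    calc ((s : A) * ρ g * (s⁻¹ : Aˣ)) * ((s : A) * ρ g⁻¹ * (s⁻¹ : Aˣ))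
        = s * (ρ g * ρ g⁻¹) * (s⁻¹ : Aˣ) := by simp [mul_assoc]
      _ = 1 := by rw [← map_mul]; simp
  rw [left_inv_eq_right_inv (hiso g) hr]
  exact hr

/-- **Jordan's theorem**: in a representation of dimension `n` with finite image, some subgroup of
index bounded in terms of `n` acts through an abelian group. -/
theorem exists_forall_representation_exists_commute_index_le (n : ℕ) : ∃ J : ℕ,
    ∀ (G : Type*) [Group G] (ρ : Representation ℂ G (Fin n → ℂ)), (MonoidHom.ker ρ).FiniteIndex →
      ∃ K : Subgroup G, K.index ≤ J ∧ K.FiniteIndex ∧ ∀ x ∈ K, ∀ y ∈ K, Commute (ρ x) (ρ y) := by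
  obtain ⟨J, hJ⟩ := exists_forall_unitary_exists_commute_index_le (EuclideanSpace ℂ (Fin n))
  refine ⟨J, fun G _ ρ hρ => ?_⟩
  let e : Module.End ℂ (Fin n → ℂ) →* (EuclideanSpace ℂ (Fin n) →L[ℂ] EuclideanSpace ℂ (Fin n)) :=
    (Module.End.toContinuousLinearMap (𝕜 := ℂ)
      (EuclideanSpace ℂ (Fin n))).toRingEquiv.toMulEquiv.toMonoidHom.comp
      ((WithLp.linearEquiv 2 ℂ (Fin n → ℂ)).symm.conjAlgEquiv ℂ).toRingEquiv.toMulEquiv.toMonoidHom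
  have he : Function.Injective e := by
    exact (Module.End.toContinuousLinearMap (𝕜 := ℂ) (EuclideanSpace ℂ (Fin n))).injective.comp
      ((WithLp.linearEquiv 2 ℂ (Fin n → ℂ)).symm.conjAlgEquiv ℂ).injective
  have hfin : (Set.range (e.comp ρ)).Finite :=
    MonoidHom.finite_range_of_finiteIndex_ker _ <|
      Subgroup.finiteIndex_of_le (H := MonoidHom.ker ρ) fun g hg => by
      rw [MonoidHom.mem_ker] at hg ⊢
      exact (congrArg e hg).trans (map_one e)
  obtain ⟨s, hs⟩ := exists_unitary_conj _ hfin
  let ψ : G →* unitary (EuclideanSpace ℂ (Fin n) →L[ℂ] EuclideanSpace ℂ (Fin n)) :=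
    { toFun := fun g => ⟨_, hs g⟩
      map_one' := Subtype.ext (by simp)
      map_mul' := fun x y => Subtype.ext (by simp [mul_assoc]) }
  have hψ : (Set.range ψ).Finite :=
    MonoidHom.finite_range_of_finiteIndex_ker _ <|
      Subgroup.finiteIndex_of_le (H := MonoidHom.ker ρ) fun g hg => by
      rw [MonoidHom.mem_ker] at hg ⊢
      apply Subtype.ext
      have h : (s : EuclideanSpace ℂ (Fin n) →L[ℂ] EuclideanSpace ℂ (Fin n)) * e (ρ g) *
          ((s⁻¹ : Units _) : EuclideanSpace ℂ (Fin n) →L[ℂ] EuclideanSpace ℂ (Fin n)) = 1 := by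
        rw [hg]; simp
      exact h
  obtain ⟨K, hK1, hK2, hK3⟩ := hJ G ψ hψ
  refine ⟨K, hK1, hK2, fun x hx y hy => ?_⟩
  have h := congrArg Subtype.val (hK3 x hx y hy).eq
  rw [← map_mul, ← map_mul] at h
  have h2 : e (ρ (x * y)) = e (ρ (y * x)) := by
    have h' : (s : EuclideanSpace ℂ (Fin n) →L[ℂ] EuclideanSpace ℂ (Fin n)) * e (ρ (x * y)) * ↑s⁻¹ =
        s * e (ρ (y * x)) * ↑s⁻¹ := h
    simpa using h'
  have h3 := he h2
  rwa [map_mul, map_mul] at h3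

end Jordan

/-! ### Irreducible constituents and induction from finite-index subgroups -/

section Constituents

variable {G : Type*} [Group G] {V : Type*} [AddCommGroup V] [Module ℂ V]

theorem Representation.isIrreducible_iff_forall_submodule (ρ : Representation ℂ G V) :
    ρ.IsIrreducible ↔ Nontrivial V ∧
      ∀ W : Submodule ℂ V, (∀ g, ∀ v ∈ W, ρ g v ∈ W) → W = ⊥ ∨ W = ⊤ := by
  constructor
  · intro h
    refine ⟨?_, fun W hW => ?_⟩
    · by_contra hV
      rw [not_nontrivial_iff_subsingleton] at hV
      exact bot_ne_top (α := Subrepresentation ρ)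
        (Subrepresentation.toSubmodule_injective (Subsingleton.elim _ _))
    · rcases eq_bot_or_eq_top (⟨W, hW⟩ : Subrepresentation ρ) with h | h
      · exact Or.inl (congrArg Subrepresentation.toSubmodule h)
      · exact Or.inr (congrArg Subrepresentation.toSubmodule h)
  · rintro ⟨hV, h⟩
    refine { exists_pair_ne := ⟨⊥, ⊤, fun hbt => ?_⟩, eq_bot_or_eq_top := fun W => ?_ }
    · exact bot_ne_top (α := Submodule ℂ V) (congrArg Subrepresentation.toSubmodule hbt)
    · refine (h W.toSubmodule W.apply_mem_toSubmodule).imp ?_ ?_ <;>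
        exact fun h => Subrepresentation.toSubmodule_injective h

/-- A nonzero finite-dimensional representation contains an irreducible one, carried by a minimal
nonzero invariant subspace and written in coordinates. -/
theorem Representation.exists_irreducible_injective [FiniteDimensional ℂ V] [Nontrivial V]
    (ρ : Representation ℂ G V) :
    ∃ (n : ℕ) (τ : Representation ℂ G (Fin n → ℂ)) (f : (Fin n → ℂ) →ₗ[ℂ] V),
      τ.IsIrreducible ∧ Function.Injective f ∧ ∀ g x, f (τ g x) = ρ g (f x) := by
  obtain ⟨W, ⟨hW, hρ⟩, hmin⟩ := exists_minimal_of_wellFoundedLT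
    (fun W : Submodule ℂ V => W ≠ ⊥ ∧ ∀ g, ∀ v ∈ W, ρ g v ∈ W) ⟨⊤, top_ne_bot, by simp⟩
  let e : (Fin (Module.finrank ℂ W) → ℂ) ≃ₗ[ℂ] W := (Module.finBasis ℂ W).equivFun.symm
  let ρW : Representation ℂ G W := Subrepresentation.toRepresentation ⟨W, hρ⟩
  let τ : Representation ℂ G (Fin (Module.finrank ℂ W) → ℂ) :=
    { toFun := fun g => e.symm.conj (ρW g)
      map_one' := by simp [Module.End.one_eq_id]
      map_mul' := fun x y => by simp [Module.End.mul_eq_comp, LinearEquiv.conj_comp] }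
  let f : (Fin (Module.finrank ℂ W) → ℂ) →ₗ[ℂ] V := W.subtype ∘ₗ e.toLinearMap
  have hf : Function.Injective f := W.subtype_injective.comp e.injective
  have hfτ (g : G) (x) : f (τ g x) = ρ g (f x) := by
    have : e (τ g x) = ρW g (e x) := by simp [τ, LinearEquiv.conj_apply]
    exact congrArg Subtype.val this
  refine ⟨_, τ, f, (isIrreducible_iff_forall_submodule τ).mpr ⟨?_, fun U hU => ?_⟩, hf, hfτ⟩
  · have : Nontrivial W := Submodule.nontrivial_iff_ne_bot.mpr hW
    exact e.toEquiv.nontrivial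
  · rw [or_iff_not_imp_left]
    intro hU0
    have hle : U.map f ≤ W := by
      rintro _ ⟨x, -, rfl⟩
      exact (e x).2
    have h1 : W ≤ U.map f := hmin ⟨fun h => hU0 <|
        Submodule.map_injective_of_injective hf (h.trans (Submodule.map_bot f).symm), by
      rintro g _ ⟨x, hx, rfl⟩
      exact ⟨τ g x, hU g x hx, hfτ g x⟩⟩ hle
    rw [eq_top_iff]
    intro x _
    obtain ⟨y, hy, hyx⟩ := h1 (e x).2
    have : y = x := hf hyx
    exact this ▸ hy

/-- The translates of a nonzero subspace stable under a finite-index subgroup span an irreducible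
representation. -/
theorem Representation.IsIrreducible.finrank_le_index_mul [FiniteDimensional ℂ V]
    {ρ : Representation ℂ G V}
    (hρ : ρ.IsIrreducible) {H : Subgroup G} [H.FiniteIndex] {W : Submodule ℂ V} (hW : W ≠ ⊥)
    (hHW : ∀ h ∈ H, ∀ v ∈ W, ρ h v ∈ W) :
    Module.finrank ℂ V ≤ H.index * Module.finrank ℂ W := by
  classical
  have := Fintype.ofFinite (G ⧸ H)
  let T : (G ⧸ H → W) →ₗ[ℂ] V :=
    ∑ q : G ⧸ H, (ρ q.out) ∘ₗ W.subtype ∘ₗ LinearMap.proj q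
  have hT (w : G ⧸ H → W) : T w = ∑ q : G ⧸ H, ρ q.out (w q) := by simp [T]
  have hmem (q : G ⧸ H) (w : W) : ρ q.out w ∈ LinearMap.range T := by
    refine ⟨Pi.single q w, ?_⟩
    rw [hT, Finset.sum_eq_single q (fun p _ hp => by simp [Pi.single_eq_of_ne hp]) (by simp),
      Pi.single_eq_same]
  have hmem' (g : G) (w : W) : ρ g w ∈ LinearMap.range T := by
    obtain ⟨h, hh⟩ := QuotientGroup.mk_out_eq_mul H g
    have h1 : ρ g w = ρ (QuotientGroup.mk g : G ⧸ H).out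
        (⟨ρ (h⁻¹ : H) w, hHW _ (h⁻¹).2 w w.2⟩ : W) := by
      rw [hh, ← Module.End.mul_apply, ← map_mul]
      simp
    rw [h1]
    exact hmem _ _
  have hsurj : LinearMap.range T = ⊤ := by
    refine (((isIrreducible_iff_forall_submodule ρ).mp hρ).2 _ ?_).resolve_left ?_
    · rintro g _ ⟨w, rfl⟩
      rw [hT, map_sum]
      refine Submodule.sum_mem _ fun q _ => ?_
      rw [← Module.End.mul_apply, ← map_mul]
      exact hmem' _ _
    · obtain ⟨w, hw, hw0⟩ := (Submodule.ne_bot_iff _).mp hW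
      refine (Submodule.ne_bot_iff _).mpr ⟨w, ?_, hw0⟩
      simpa using hmem' 1 ⟨w, hw⟩
  calc Module.finrank ℂ V ≤ Module.finrank ℂ (G ⧸ H → W) :=
        LinearMap.finrank_le_finrank_of_surjective (LinearMap.range_eq_top.mp hsurj)
    _ = H.index * Module.finrank ℂ W := by
        rw [Module.finrank_pi_fintype]
        simp [Subgroup.index, Nat.card_eq_fintype_card]

/-- The underlying space of `σ ⊗ Ind χ`: the functions `F : G → V` with `F (h g) = χ h • F g` for
`h` in the subgroup `H`. -/
def twistedFunctions (V : Type*) [AddCommGroup V] [Module ℂ V] {H : Subgroup G} (χ : H →* ℂˣ) :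
    Submodule ℂ (G → V) where
  carrier := {F | ∀ (h : H) (g : G), F (h * g) = (χ h : ℂ) • F g}
  add_mem' hF hF' h g := by simp [hF h g, hF' h g]
  zero_mem' h g := by simp
  smul_mem' c F hF h g := by simp [hF h g, smul_comm c]

/-- The representation `σ ⊗ Ind χ` of `G`: right translation of the argument combined with the
action of `σ` on values. -/
def twistedRepresentation (σ : Representation ℂ G V) {H : Subgroup G} (χ : H →* ℂˣ) :
    Representation ℂ G (twistedFunctions V χ) where
  toFun x :=
    { toFun := fun F => ⟨fun g => σ x (F.1 (g * x)), fun h g => by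
        change σ x (F.1 (h * g * x)) = (χ h : ℂ) • σ x (F.1 (g * x))
        rw [mul_assoc, F.2 h, map_smul]⟩
      map_add' := fun F F' => Subtype.ext (funext fun g => by simp)
      map_smul' := fun c F => Subtype.ext (funext fun g => by simp) }
  map_one' := LinearMap.ext fun F => Subtype.ext (funext fun g => by simp)
  map_mul' x y := LinearMap.ext fun F => Subtype.ext (funext fun g => by simp [mul_assoc])

/-- A twisted function is determined by its values on coset representatives. -/
theorem exists_injective_twistedFunctions {H : Subgroup G} [H.FiniteIndex] (χ : H →* ℂˣ) :
    ∃ f : twistedFunctions V χ →ₗ[ℂ] (G ⧸ H → V), Function.Injective f := by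
  -- the cosets `H g` correspond to the cosets `g⁻¹ H`
  refine ⟨LinearMap.pi fun q => LinearMap.proj q.out⁻¹ ∘ₗ (twistedFunctions V χ).subtype, ?_⟩
  rw [injective_iff_map_eq_zero]
  intro F hF
  refine Subtype.ext (funext fun g => ?_)
  obtain ⟨h, hh⟩ := QuotientGroup.mk_out_eq_mul H g⁻¹
  have h1 : F.1 (QuotientGroup.mk g⁻¹ : G ⧸ H).out⁻¹ = 0 := congrFun hF (QuotientGroup.mk g⁻¹)
  have h2 : (QuotientGroup.mk g⁻¹ : G ⧸ H).out⁻¹ = ((h⁻¹ : H) : G) * g := by rw [hh]; simp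
  rw [h2, F.2] at h1
  exact (smul_eq_zero.mp h1).resolve_left (Units.ne_zero _)

instance [FiniteDimensional ℂ V] {H : Subgroup G} [H.FiniteIndex] (χ : H →* ℂˣ) :
    FiniteDimensional ℂ (twistedFunctions V χ) :=
  have ⟨f, hf⟩ := exists_injective_twistedFunctions (V := V) χ
  FiniteDimensional.of_injective f hf

theorem finrank_twistedFunctions_le [FiniteDimensional ℂ V] {H : Subgroup G} [H.FiniteIndex]
    (χ : H →* ℂˣ) :
    Module.finrank ℂ (twistedFunctions V χ) ≤ H.index * Module.finrank ℂ V := by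
  have := Fintype.ofFinite (G ⧸ H)
  obtain ⟨f, hf⟩ := exists_injective_twistedFunctions (V := V) χ
  refine (LinearMap.finrank_le_finrank_of_injective hf).trans_eq ?_
  rw [Module.finrank_pi_fintype]
  simp [Subgroup.index, Nat.card_eq_fintype_card]

instance [Nontrivial V] {H : Subgroup G} (χ : H →* ℂˣ) : Nontrivial (twistedFunctions V χ) := by
  classical
  obtain ⟨v, hv⟩ := exists_ne (0 : V)
  let F : G → V := fun g => if hg : g ∈ H then (χ ⟨g, hg⟩ : ℂ) • v else 0
  have hF : F ∈ twistedFunctions V χ := by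
    intro h g
    by_cases hg : g ∈ H
    · have h1 : (h : G) * g ∈ H := H.mul_mem h.2 hg
      have h2 : (⟨h * g, h1⟩ : H) = h * ⟨g, hg⟩ := rfl
      simp only [F, dif_pos hg, dif_pos h1, h2, map_mul, Units.val_mul, mul_smul]
    · have h1 : (h : G) * g ∉ H := fun h1 => hg ((H.mul_mem_cancel_left h.2).mp h1)
      simp only [F, dif_neg hg, dif_neg h1, smul_zero]
  refine ⟨⟨F, hF⟩, 0, fun h => hv ?_⟩
  have h1 : F 1 = 0 := congrFun (congrArg Subtype.val h) 1
  have h2 : (⟨1, H.one_mem⟩ : H) = 1 := rfl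
  simpa [F, H.one_mem, h2] using h1

theorem finiteIndex_ker_twistedRepresentation (σ : Representation ℂ G V) {H : Subgroup G}
    [H.FiniteIndex] (χ : H →* ℂˣ) (hσ : (MonoidHom.ker σ).FiniteIndex) (hχ : χ.ker.FiniteIndex) :
    (MonoidHom.ker (twistedRepresentation σ χ)).FiniteIndex := by
  have h1 : (χ.ker.map H.subtype).FiniteIndex := by
    refine ⟨?_⟩
    rw [Subgroup.index_map_subtype]
    exact mul_ne_zero hχ.index_ne_zero Subgroup.FiniteIndex.index_ne_zero
  refine Subgroup.finiteIndex_of_le (H := (χ.ker.map H.subtype).normalCore ⊓ MonoidHom.ker σ) ?_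
  rintro x ⟨hx1, hx2⟩
  refine LinearMap.ext fun F => Subtype.ext (funext fun g => ?_)
  obtain ⟨h, hh, hhx⟩ := hx1 g
  have hx2 : σ x = 1 := hx2
  have hh : χ h = 1 := hh
  change σ x (F.1 (g * x)) = F.1 g
  have h2 : g * x = h * g := by
    have : (h : G) = g * x * g⁻¹ := hhx
    rw [this]; simp
  rw [hx2, h2, F.2, hh]; simp

/-- Frobenius reciprocity for `σ ⊗ Ind χ`: it contains an irreducible representation whose
restriction to `H` maps nontrivially to the twist of `σ` by `χ`. -/
theorem exists_finiteImageIrrep_twist [FiniteDimensional ℂ V] [Nontrivial V]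
    (σ : Representation ℂ G V) {H : Subgroup G} [H.FiniteIndex] (χ : H →* ℂˣ)
    (hσ : (MonoidHom.ker σ).FiniteIndex) (hχ : χ.ker.FiniteIndex) :
    ∃ (n : ℕ) (τ : FiniteImageIrrep G n) (L : (Fin n → ℂ) →ₗ[ℂ] V),
      n ≤ H.index * Module.finrank ℂ V ∧ L ≠ 0 ∧
        ∀ (h : H) x, L (τ.1 h x) = (χ h : ℂ) • σ h (L x) := by
  obtain ⟨n, τ, f, hτ, hf, hfτ⟩ := (twistedRepresentation σ χ).exists_irreducible_injective
  have hker : (MonoidHom.ker τ).FiniteIndex := by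
    have := finiteIndex_ker_twistedRepresentation σ χ hσ hχ
    refine Subgroup.finiteIndex_of_le (H := MonoidHom.ker (twistedRepresentation σ χ)) ?_
    intro g hg
    rw [MonoidHom.mem_ker] at hg ⊢
    exact LinearMap.ext fun x => hf (by rw [hfτ, hg]; rfl)
  refine ⟨n, ⟨τ, hτ, hker⟩,
    LinearMap.proj 1 ∘ₗ (twistedFunctions V χ).subtype ∘ₗ f, ?_, fun hL => ?_, fun h x => ?_⟩
  · have := (LinearMap.finrank_le_finrank_of_injective hf).trans (finrank_twistedFunctions_le χ)
    simpa using this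
  · have := ((Representation.isIrreducible_iff_forall_submodule τ).mp hτ).1
    obtain ⟨x, hx⟩ := exists_ne (0 : Fin n → ℂ)
    refine hx (hf ?_)
    rw [map_zero]
    refine Subtype.ext (funext fun g => ?_)
    have h1 : (f (τ g x)).1 1 = 0 := LinearMap.congr_fun hL (τ g x)
    rw [hfτ] at h1
    have h2 : σ g ((f x).1 (1 * g)) = 0 := h1
    have h3 := congrArg (σ g⁻¹) h2
    rw [← Module.End.mul_apply, ← map_mul] at h3
    simpa using h3
  · change (f (τ h x)).1 1 = (χ h : ℂ) • σ h ((f x).1 1)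
    rw [hfτ]
    change σ h ((f x).1 (1 * h)) = _
    rw [one_mul, ← mul_one (h : G), (f x).2 h 1, map_smul, mul_one]

end Constituents

/-! ### Finiteness and separation properties -/

/-- A finite group has finitely many irreducible representations on a given space, up to
isomorphism: each is a simple module over the semisimple group algebra, hence determined by one of
its finitely many isotypic components. -/
theorem exists_isotypicComponent_classifying_irreducible (Q : Type*) [Group Q] [Finite Q]
    (V : Type*) [AddCommGroup V] [Module ℂ V] :
    ∃ c : {ρ : Representation ℂ Q V // ρ.IsIrreducible} →
        isotypicComponents (MonoidAlgebra ℂ Q) (MonoidAlgebra ℂ Q),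
      ∀ ρ σ, c ρ = c σ → Nonempty (ρ.1.Equiv σ.1) := by
  have : NeZero (Nat.card Q : ℂ) := ⟨Nat.cast_ne_zero.mpr Nat.card_pos.ne'⟩
  have hI (ρ : {ρ : Representation ℂ Q V // ρ.IsIrreducible}) :
      ∃ I : Submodule (MonoidAlgebra ℂ Q) (MonoidAlgebra ℂ Q),
        IsSimpleModule (MonoidAlgebra ℂ Q) I ∧ Nonempty (ρ.1.asModule ≃ₗ[MonoidAlgebra ℂ Q] I) := by
    have := ρ.2
    obtain ⟨I, ⟨e⟩⟩ := IsSemisimpleRing.exists_linearEquiv_ideal_of_isSimpleModule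
      (MonoidAlgebra ℂ Q) ρ.1.asModule
    exact ⟨I, IsSimpleModule.congr e.symm, ⟨e⟩⟩
  choose I hI e using hI
  refine ⟨fun ρ => ⟨isotypicComponent _ _ (I ρ), I ρ, hI ρ, rfl⟩, fun ρ σ h => ?_⟩
  have h : isotypicComponent (MonoidAlgebra ℂ Q) (MonoidAlgebra ℂ Q) (I ρ) =
    isotypicComponent _ _ (I σ) := congrArg Subtype.val h
  have := hI σ
  have hle : I ρ ≤ isotypicComponent (MonoidAlgebra ℂ Q) (MonoidAlgebra ℂ Q) (I σ) :=
    h ▸ le_sSup ⟨LinearEquiv.refl _ _⟩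
  have := hI ρ
  obtain ⟨e'⟩ := isIsotypicOfType_submodule_iff.mp
    (IsIsotypicOfType.isotypicComponent (MonoidAlgebra ℂ Q) (MonoidAlgebra ℂ Q) (I σ)) _ hle
  let E := ((e ρ).some.trans e').trans (e σ).some.symm
  let F := (Representation.IntertwiningMap.equivLinearMapAsModule ρ.1 σ.1).symm E.toLinearMap
  exact ⟨F.ofBijective E.bijective⟩

section Kernels

variable (G : Type*) [Group G]

/-- The common kernel of all irreducible representations of dimension `n` with finite image. -/
def irrepKernel (n : ℕ) : Subgroup G :=
  ⨅ τ : FiniteImageIrrep G n, MonoidHom.ker τ.1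

variable {G}

theorem mem_irrepKernel {n : ℕ} {g : G} :
    g ∈ irrepKernel G n ↔ ∀ τ : FiniteImageIrrep G n, τ.1 g = 1 := by
  simp [irrepKernel, Subgroup.mem_iInf, MonoidHom.mem_ker]

/-- Equivalent representations have equal kernels, so the common kernel is a finite intersection. -/
theorem finiteIndex_irrepKernel {n : ℕ} (h : repCount G n ≠ ⊤) :
    (irrepKernel G n).FiniteIndex := by
  have hfin : Finite (Quotient (FiniteImageIrrep.setoid G n)) := by
    by_contra hinf
    rw [not_finite_iff_infinite] at hinf
    exact h (ENat.card_eq_top_of_infinite)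
  have h1 : (⨅ q : Quotient (FiniteImageIrrep.setoid G n), MonoidHom.ker q.out.1).FiniteIndex :=
    Subgroup.finiteIndex_iInf fun q => q.out.2.2
  refine Subgroup.finiteIndex_of_le
    (H := ⨅ q : Quotient (FiniteImageIrrep.setoid G n), MonoidHom.ker q.out.1) fun g hg => ?_
  rw [mem_irrepKernel]
  intro τ
  rw [Subgroup.mem_iInf] at hg
  have h2 : (⟦τ⟧ : Quotient (FiniteImageIrrep.setoid G n)).out.1 g = 1 := hg ⟦τ⟧
  obtain ⟨e⟩ : Nonempty (Representation.Equiv (⟦τ⟧ : Quotient (FiniteImageIrrep.setoid G n)).out.1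
      τ.1) := Quotient.mk_out (s := FiniteImageIrrep.setoid G n) τ
  rw [← e.conj_apply_self, h2]
  exact LinearMap.ext fun x => e.toLinearEquiv.apply_symm_apply x

/-- All irreducible representations of dimension `n` factor through the finite quotient by their
common kernel. -/
theorem repCount_ne_top {n : ℕ} (h : (irrepKernel G n).FiniteIndex) : repCount G n ≠ ⊤ := by
  have hnormal : (irrepKernel G n).Normal := Subgroup.normal_iInf_normal fun _ => inferInstance
  let Q := G ⧸ irrepKernel G n
  obtain ⟨c, hc⟩ := exists_isotypicComponent_classifying_irreducible Q (Fin n → ℂ)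
  let desc (τ : FiniteImageIrrep G n) : Representation ℂ Q (Fin n → ℂ) :=
    QuotientGroup.lift (irrepKernel G n) τ.1 fun g hg => mem_irrepKernel.mp hg τ
  have hdesc (τ : FiniteImageIrrep G n) : (desc τ).IsIrreducible := by
    rw [Representation.isIrreducible_iff_forall_submodule]
    refine ((Representation.isIrreducible_iff_forall_submodule τ.1).mp τ.2.1).imp id ?_
    exact fun h W hW => h W fun g => hW (QuotientGroup.mk g)
  have hinj (τ τ' : FiniteImageIrrep G n) (h : c ⟨desc τ, hdesc τ⟩ = c ⟨desc τ', hdesc τ'⟩) :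
      Nonempty (Representation.Equiv τ.1 τ'.1) := by
    obtain ⟨e⟩ := hc _ _ h
    exact ⟨.mk e.toLinearEquiv fun g => e.isIntertwining' (QuotientGroup.mk g)⟩
  have hfin : Finite (Quotient (FiniteImageIrrep.setoid G n)) := by
    refine Finite.of_injective
      (fun q : Quotient (FiniteImageIrrep.setoid G n) => c ⟨desc q.out, hdesc q.out⟩) ?_
    intro p q hpq
    rw [← p.out_eq, ← q.out_eq]
    exact Quotient.sound (hinj _ _ hpq)
  exact (ENat.card_lt_top.mpr hfin).ne

theorem repCount_eq_zero_iff {n : ℕ} : repCount G n = 0 ↔ IsEmpty (FiniteImageIrrep G n) := by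
  rw [repCount, ENat.card_eq_zero_iff_empty]
  exact ⟨fun h => ⟨fun τ => h.false ⟦τ⟧⟩, fun h => ⟨fun q => h.false q.out⟩⟩

end Kernels

/-- In a finitely generated group, a finite-index subgroup lies in all subgroups of index at most
`J`. -/
theorem exists_finiteIndex_forall_le_of_index_le (G : Type*) [Group G] [Group.FG G] (J : ℕ) :
    ∃ H : Subgroup G, H.FiniteIndex ∧
      ∀ K : Subgroup G, K.FiniteIndex → K.index ≤ J → H ≤ K := by
  obtain ⟨S, hS⟩ := Group.FG.out (G := G)
  have hfin (k : ℕ) : Finite (G →* Equiv.Perm (Fin k)) :=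
    Finite.of_injective (fun f : G →* Equiv.Perm (Fin k) => fun s : S => f s) fun f f' h =>
      MonoidHom.eq_of_eqOn_dense hS fun s hs => congrFun h ⟨s, hs⟩
  let H : Subgroup G := ⨅ p : Σ k : Fin (J + 1), G →* Equiv.Perm (Fin k), p.2.ker
  refine ⟨H, Subgroup.finiteIndex_iInf fun p => inferInstance, fun K hK hKJ g hg => ?_⟩
  let e : G ⧸ K ≃ Fin K.index := Finite.equivFin (G ⧸ K)
  let f : G →* Equiv.Perm (Fin K.index) :=
    (e.permCongrHom : Equiv.Perm (G ⧸ K) →* Equiv.Perm (Fin K.index)).comp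
      (MulAction.toPermHom G (G ⧸ K))
  have h1 : f g = 1 := Subgroup.mem_iInf.mp hg ⟨⟨K.index, Nat.lt_succ_of_le hKJ⟩, f⟩
  have h2 : MulAction.toPermHom G (G ⧸ K) g = 1 :=
    (MulEquiv.map_eq_one_iff e.permCongrHom).mp h1
  have h3 : g • (QuotientGroup.mk 1 : G ⧸ K) = QuotientGroup.mk 1 :=
    Equiv.congr_fun h2 (QuotientGroup.mk 1 : G ⧸ K)
  have h4 : (QuotientGroup.mk 1 : G ⧸ K) = QuotientGroup.mk (g * 1) := h3.symm
  rw [QuotientGroup.eq] at h4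
  simpa using h4

/-- If the image `f(H)` is finite and commutative and `f g ≠ 1`, some character of `H` with
finite image separates `g` from `1`. -/
theorem exists_character_apply_ne_one {H M : Type*} [Group H] [Monoid M] (f : H →* M)
    (hker : f.ker.FiniteIndex) (hcomm : ∀ x y, Commute (f x) (f y)) {g : H} (hg : f g ≠ 1) :
    ∃ χ : H →* ℂˣ, χ.ker.FiniteIndex ∧ χ g ≠ 1 := by
  let A := H ⧸ f.ker
  let _ : CommGroup A :=
    { (inferInstance : Group A) with
      mul_comm := fun a b => by
        induction a using QuotientGroup.induction_on with | H x => ?_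
        induction b using QuotientGroup.induction_on with | H y => ?_
        refine QuotientGroup.eq.mpr ?_
        have h1 : f (x * y) = f (y * x) := by rw [map_mul, map_mul]; exact (hcomm x y).eq
        rw [MonoidHom.mem_ker, map_mul, ← h1, ← map_mul, inv_mul_cancel, map_one] }
  have : Finite A := Subgroup.finite_quotient_of_finiteIndex
  have hgA : (QuotientGroup.mk g : A) ≠ 1 := fun h =>
    hg ((QuotientGroup.eq_one_iff g).mp h)
  have : NeZero (Monoid.exponent A) := ⟨Monoid.exponent_ne_zero_of_finite⟩
  obtain ⟨ψ, hψ⟩ := CommGroup.exists_apply_ne_one_of_hasEnoughRootsOfUnity A ℂ hgA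
  refine ⟨ψ.comp (QuotientGroup.mk' f.ker), ?_, hψ⟩
  refine Subgroup.finiteIndex_of_le (H := f.ker) fun x hx => ?_
  rw [MonoidHom.mem_ker, MonoidHom.comp_apply]
  have : QuotientGroup.mk' f.ker x = 1 := (QuotientGroup.eq_one_iff x).mpr hx
  rw [this, map_one]

/-- The irreducible representations with finite image separate the points of a residually finite
group: a nontrivial element `g` of a finite quotient acts nontrivially on every constituent of the
representation induced from a character of `⟨g⟩` that is nontrivial at `g`. -/
theorem exists_finiteImageIrrep_apply_ne_one {G : Type*} [Group G] [Group.ResiduallyFinite G]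
    {g : G} (hg : g ≠ 1) : ∃ (n : ℕ) (τ : FiniteImageIrrep G n), τ.1 g ≠ 1 := by
  obtain ⟨N, hN⟩ := Group.exists_finiteIndexNormalSubgroup_notMem g hg
  let π : G →* G ⧸ N.toSubgroup := QuotientGroup.mk' N.toSubgroup
  have hfin : Finite (G ⧸ N.toSubgroup) := inferInstance
  let H : Subgroup G := (Subgroup.zpowers (π g)).comap π
  have hNH : N.toSubgroup ≤ H := fun x hx => by
    have : π x = 1 := (QuotientGroup.eq_one_iff x).mpr hx
    change π x ∈ Subgroup.zpowers (π g)
    rw [this]; exact one_mem _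
  have : H.FiniteIndex := Subgroup.finiteIndex_of_le hNH
  have hgH : g ∈ H := Subgroup.mem_zpowers (π g)
  have hker : (π.comp H.subtype).ker.FiniteIndex := inferInstance
  obtain ⟨χ, hχ, hχg⟩ := exists_character_apply_ne_one (π.comp H.subtype) hker
    (fun x y => by
      obtain ⟨a, ha⟩ := x.2
      obtain ⟨b, hb⟩ := y.2
      change Commute (π x) (π y)
      rw [← ha, ← hb]
      exact (Commute.refl (π g)).zpow_zpow a b)
    (g := ⟨g, hgH⟩) (fun h => hN ((QuotientGroup.eq_one_iff g).mp h))
  obtain ⟨n, τ, L, -, hL, hLτ⟩ := exists_finiteImageIrrep_twist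
    (Representation.trivial ℂ G ℂ) χ (by
      have : MonoidHom.ker (Representation.trivial ℂ G ℂ) = ⊤ := by
        ext x; simp [Representation.trivial]
      rw [this]; infer_instance) hχ
  refine ⟨n, τ, fun h1 => hL (LinearMap.ext fun x => ?_)⟩
  have h2 := hLτ ⟨g, hgH⟩ x
  rw [h1] at h2
  have h3 : L x = (χ ⟨g, hgH⟩ : ℂ) * L x := h2
  by_contra hx
  apply hχg
  apply Units.ext
  exact mul_right_cancel₀ hx (by rw [← h3, Units.val_one, one_mul])

/-! ### The equivalence -/

/-- An irreducible constituent of the restriction to the abelian group `A` is a line, whose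
translates span the space. -/
theorem FiniteImageIrrep.dim_le_index_of_commute {G : Type*} [Group G] {n : ℕ}
    (τ : FiniteImageIrrep G n) {A : Subgroup G} [A.FiniteIndex]
    (hA : ∀ x ∈ A, ∀ y ∈ A, x * y = y * x) : n ≤ A.index := by
  have := ((Representation.isIrreducible_iff_forall_submodule τ.1).mp τ.2.1).1
  have : IsMulCommutative A := ⟨⟨fun x y => Subtype.ext (hA x x.2 y y.2)⟩⟩
  let ρ : Representation ℂ A (Fin n → ℂ) := τ.1.comp A.subtype
  obtain ⟨k, σ, f, hσ, hf, hfσ⟩ := ρ.exists_irreducible_injective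
  have hk := Representation.IsIrreducible.finrank_eq_one_of_isMulCommutative σ
  have hrange : Module.finrank ℂ (LinearMap.range f) = 1 := by
    rw [LinearMap.finrank_range_of_inj hf, hk]
  have h := Representation.IsIrreducible.finrank_le_index_mul τ.2.1 (H := A)
    (W := LinearMap.range f) (fun h => by rw [h, finrank_bot] at hrange; omega)
    (by
      rintro h hh _ ⟨x, rfl⟩
      exact ⟨σ ⟨h, hh⟩ x, hfσ ⟨h, hh⟩ x⟩)
  simpa [hrange] using h

/-- In a finitely generated group, one finite-index subgroup is contained in all the subgroups that
Jordan's theorem provides in dimensions below `N`. -/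
theorem exists_finiteIndex_commute (G : Type*) [Group G] [Group.FG G] (N : ℕ) :
    ∃ H : Subgroup G, H.FiniteIndex ∧ ∀ n < N, ∀ τ : FiniteImageIrrep G n,
      ∀ x ∈ H, ∀ y ∈ H, Commute (τ.1 x) (τ.1 y) := by
  choose J hJ using exists_forall_representation_exists_commute_index_le
  obtain ⟨H, hH, hle⟩ := exists_finiteIndex_forall_le_of_index_le G ((Finset.range N).sup J)
  refine ⟨H, hH, fun n hn τ x hx y hy => ?_⟩
  obtain ⟨K, hKJ, hK, hcomm⟩ := hJ n G τ.1 τ.2.2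
  have hHK := hle K hK (hKJ.trans (Finset.le_sup (Finset.mem_range.mpr hn)))
  exact hcomm x (hHK hx) y (hHK hy)

/-- By residual finiteness, a subgroup acting through abelian groups in every irreducible
representation is abelian. -/
theorem isVirtuallyAbelian_of_repCount_eq_zero (G : Type*) [Group G] [Group.FG G]
    [Group.ResiduallyFinite G] {N : ℕ} (h : ∀ i, N ≤ i → repCount G i = 0) :
    IsVirtuallyAbelian G := by
  obtain ⟨H, hH, hcomm⟩ := exists_finiteIndex_commute G N
  refine ⟨H, hH, fun x hx y hy => ?_⟩
  by_contra hxy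
  obtain ⟨n, τ, hτ⟩ := exists_finiteImageIrrep_apply_ne_one
    (g := x * y * (y * x)⁻¹) (fun h1 => hxy (mul_inv_eq_one.mp h1))
  have hn : n < N := by
    by_contra hn
    exact (repCount_eq_zero_iff.mp (h n (not_lt.mp hn))).false τ
  apply hτ
  have h1 : τ.1 (x * y) = τ.1 (y * x) := by
    rw [map_mul, map_mul]; exact (hcomm n hn τ x hx y hy).eq
  rw [map_mul, h1, ← map_mul, mul_inv_cancel, map_one]

/-- Finitely many irreducible representations have a common kernel of finite index, so they cannot
separate the points of an infinite group. -/
theorem infiniteDegrees_nonempty (G : Type*) [Group G] [Infinite G] [Group.ResiduallyFinite G]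
    {N : ℕ} (h : ∀ i, N ≤ i → repCount G i = 0) : (infiniteDegrees G).Nonempty := by
  by_contra hempty
  rw [Set.not_nonempty_iff_eq_empty, Set.eq_empty_iff_forall_notMem] at hempty
  have hfin : (⨅ i : Fin N, irrepKernel G i).FiniteIndex :=
    Subgroup.finiteIndex_iInf fun i => finiteIndex_irrepKernel (hempty i)
  have hbot : (⨅ i : Fin N, irrepKernel G i) = ⊥ := by
    rw [eq_bot_iff]
    intro g hg
    by_contra hg1
    obtain ⟨n, τ, hτ⟩ := exists_finiteImageIrrep_apply_ne_one (g := g) hg1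
    have hn : n < N := by
      by_contra hn
      exact (repCount_eq_zero_iff.mp (h n (not_lt.mp hn))).false τ
    exact hτ (mem_irrepKernel.mp (Subgroup.mem_iInf.mp hg ⟨n, hn⟩) τ)
  rw [hbot] at hfin
  have := hfin.index_ne_zero
  rw [Subgroup.index_bot] at this
  exact this Nat.card_eq_zero_of_infinite

/-- The common kernel of the characters of `H` with finite image. -/
def characterKernel (H : Type*) [Group H] : Subgroup H :=
  ⨅ χ : {χ : H →* ℂˣ // χ.ker.FiniteIndex}, χ.1.ker

/-- If a finite-index subgroup `H` acts through abelian groups in the infinitely many irreducible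
representations of some dimension, then `H` has many characters. -/
theorem not_finiteIndex_characterKernel {G : Type*} [Group G] {n : ℕ} (hn : repCount G n = ⊤)
    (H : Subgroup G) [hH : H.FiniteIndex]
    (hcomm : ∀ τ : FiniteImageIrrep G n, ∀ x ∈ H, ∀ y ∈ H, Commute (τ.1 x) (τ.1 y)) :
    ¬ (characterKernel H).FiniteIndex := by
  intro hfin
  refine repCount_ne_top ?_ hn
  have h1 : ((characterKernel H).map H.subtype).FiniteIndex := by
    refine ⟨?_⟩
    rw [Subgroup.index_map_subtype]
    exact mul_ne_zero hfin.index_ne_zero hH.index_ne_zero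
  refine Subgroup.finiteIndex_of_le (H := (characterKernel H).map H.subtype) ?_
  rintro _ ⟨g, hg, rfl⟩
  refine mem_irrepKernel.mpr fun τ => ?_
  by_contra hτ
  obtain ⟨χ, hχ, hχg⟩ := exists_character_apply_ne_one (τ.1.comp H.subtype)
    (by
      have := τ.2.2
      have h2 : ((MonoidHom.ker τ.1).subgroupOf H).FiniteIndex := inferInstance
      exact h2)
    (fun x y => hcomm τ x x.2 y y.2) hτ
  exact hχg (Subgroup.mem_iInf.mp hg ⟨χ, hχ⟩)

/-- Let `H` have so many characters `χ` that their common kernel has infinite index. For an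
irreducible `σ`, the constituents of `σ ⊗ Ind χ` have dimensions between `dim σ / [G : H]` and
`[G : H] dim σ`. If there were finitely many irreducible representations in this range, their
common kernel, which determines `χ` on `ker σ`, would have finite index. -/
theorem repCount_eq_zero_of_not_finiteIndex_characterKernel {G : Type*} [Group G]
    (H : Subgroup G) [hH : H.FiniteIndex] (hchar : ¬ (characterKernel H).FiniteIndex) {B : ℕ}
    (hB : ∀ i, B ≤ i → repCount G i ≠ ⊤) {m : ℕ} (hm : H.index * B ≤ m) : repCount G m = 0 := by
  rw [repCount_eq_zero_iff]
  refine ⟨fun σ => hchar ?_⟩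
  have := ((Representation.isIrreducible_iff_forall_submodule σ.1).mp σ.2.1).1
  let K : Subgroup G := ⨅ i : Set.Icc B (H.index * m), irrepKernel G i
  have hK : K.FiniteIndex :=
    Subgroup.finiteIndex_iInf fun i => finiteIndex_irrepKernel (hB i i.2.1)
  have := σ.2.2
  refine Subgroup.finiteIndex_of_le (H := (K ⊓ MonoidHom.ker σ.1).subgroupOf H) ?_
  rintro h ⟨hhK, hhσ⟩
  refine Subgroup.mem_iInf.mpr fun χ => ?_
  obtain ⟨n, τ, L, hn, hL, hLτ⟩ := exists_finiteImageIrrep_twist σ.1 χ.1 σ.2.2 χ.2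
  rw [Module.finrank_fin_fun] at hn
  -- the image of `L` is stable under `H`, because twisting by `χ` only rescales
  have hdim := Representation.IsIrreducible.finrank_le_index_mul σ.2.1 (H := H)
    (W := LinearMap.range L) (fun h => hL (LinearMap.range_eq_bot.mp h)) (by
      rintro g hg _ ⟨x, rfl⟩
      refine ⟨((χ.1 ⟨g, hg⟩)⁻¹ : ℂˣ) • τ.1 g x, ?_⟩
      rw [Units.smul_def, map_smul, hLτ ⟨g, hg⟩ x, smul_smul, Units.inv_mul, one_smul])
  rw [Module.finrank_fin_fun] at hdim
  have hrange : Module.finrank ℂ (LinearMap.range L) ≤ n := by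
    simpa using LinearMap.finrank_range_le L
  have hBn : B ≤ n := by
    have hpos : 0 < H.index := Nat.pos_of_ne_zero hH.index_ne_zero
    exact Nat.le_of_mul_le_mul_left (hm.trans (hdim.trans (Nat.mul_le_mul_left _ hrange))) hpos
  have hτ : τ.1 h = 1 := mem_irrepKernel.mp (Subgroup.mem_iInf.mp hhK ⟨n, hBn, hn⟩) τ
  have hσ : σ.1 h = 1 := hhσ
  obtain ⟨x, hx⟩ : ∃ x, L x ≠ 0 := by
    by_contra! h0
    exact hL (LinearMap.ext h0)
  have h1 := hLτ h x
  rw [hτ, hσ, Module.End.one_apply, Module.End.one_apply] at h1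
  refine MonoidHom.mem_ker.mpr (Units.ext (smul_left_injective ℂ hx ?_))
  simpa using h1.symm

theorem theoremB (G : Type*) [Group G] [Infinite G] [Group.FG G] [Group.ResiduallyFinite G] :
    List.TFAE
      [(infiniteDegrees G).Finite ∧ (infiniteDegrees G).Nonempty,
        ∃ N : ℕ, ∀ i : ℕ, N ≤ i → repCount G i = 0,
        IsVirtuallyAbelian G] := by
  tfae_have 1 → 2 := by
    rintro ⟨hfin, n, hn⟩
    obtain ⟨H, hH, hcomm⟩ := exists_finiteIndex_commute G (n + 1)
    have hchar := not_finiteIndex_characterKernel hn H (hcomm n n.lt_succ_self)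
    obtain ⟨B, hB⟩ := hfin.bddAbove
    refine ⟨H.index * (B + 1), fun m hm =>
      repCount_eq_zero_of_not_finiteIndex_characterKernel H hchar (B := B + 1) ?_ hm⟩
    intro i hi htop
    have : i ≤ B := hB htop
    omega
  tfae_have 2 → 3 := by
    rintro ⟨N, hN⟩
    exact isVirtuallyAbelian_of_repCount_eq_zero G hN
  tfae_have 3 → 2 := by
    rintro ⟨A, hA, hcomm⟩
    refine ⟨A.index + 1, fun i hi => repCount_eq_zero_iff.mpr ⟨fun τ => ?_⟩⟩
    have := FiniteImageIrrep.dim_le_index_of_commute τ hcomm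
    omega
  tfae_have 2 → 1 := by
    rintro ⟨N, hN⟩
    refine ⟨(Set.finite_lt_nat N).subset fun i hi => ?_, infiniteDegrees_nonempty G hN⟩
    by_contra hiN
    have h0 := hN i (not_lt.mp hiN)
    rw [show repCount G i = ⊤ from hi] at h0
    exact ENat.top_ne_zero h0
  tfae_finish
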